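/- For a finitely generated group $G$ let $\mathrm r(G)$ be the least number of generators of $G$ and $\tilde{\mathrm r}(G)=\max\{0,\mathrm r(G)-1\}$. For a finitely generated subgroup $H$ of a group $G$, the degree of compression of $H$ in $G$ is $\mathrm{dc}_G(H)=\sup_K\,\tilde{\mathrm r}(H)/\tilde{\mathrm r}(K)$, where $K$ runs over all finitely generated subgroups with $H\le K\le G$, and $0/0$ is understood to be $1$. A finitely generated subgroup $K\ge H$ is an algebraic extension of $H$ if $H$ is contained in no proper free factor of $K$, i.e. if $H\le A\le K=A*B$ implies $B=1$; let $\mathcal{AE}_G(H)$ be the set of algebraic extensions of $H$ in $G$. Theorem. Let $F_n$ be the free group of finite rank $n\ge 0$ on the letters $x_1,\dots,x_n$. (1) For every finitely generated subgroup $H\le F_n$, the supremum that defines $\mathrm{dc}_{F_n}(H)$ is attained, the set $\mathcal{AE}_{F_n}(H)$ is finite, and $$\mathrm{dc}_{F_n}(H)=\max_{K\in\mathcal{AE}_{F_n}(H)}\tilde{\mathrm r}(H)/\tilde{\mathrm r}(K).$$ (2) The function $\mathrm{dc}_{F_n}$ is computable: there is an algorithm (a total computable function) which, given words in $x_1^{\pm1},\dots,x_n^{\pm1}$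 that represent elements $h_1,\dots,h_r\in F_n$ ($r\ge 0$), outputs the rational number $\mathrm{dc}_{F_n}(H)$ for $H=\langle h_1,\dots,h_r\rangle$, as a reduced fraction, together with words that represent a free basis of a subgroup $K\in\mathcal{AE}_{F_n}(H)$ with $\tilde{\mathrm r}(H)/\tilde{\mathrm r}(K)=\mathrm{dc}_{F_n}(H)$ (with $0/0=1$ as above). -/

import Mathlib

namespace FreeCompression

/-- The reduced rank `max {0, r(G) - 1}` of a finitely generated group, where `r(G)` is the least
number of generators (the subtraction of natural numbers is truncated at zero). -/
noncomputable def reducedRank (G : Type*) [Group G] [Group.FG G] : ℕ :=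
  Group.rank G - 1

/-- The quotient of the reduced ranks of `H` and `K`, where `0 / 0` is understood to be `1`.
(If `H ≤ K` and `K` has reduced rank `0`, then `K` and `H` are cyclic, so `0 / 0` is the only case
with a zero denominator that occurs for `H ≤ K`.) -/
noncomputable def compressionRatio {G : Type*} [Group G] (H K : Subgroup G)
    [Group.FG H] [Group.FG K] : ℝ :=
  if reducedRank H = 0 ∧ reducedRank K = 0 then 1
  else (reducedRank H : ℝ) / (reducedRank K : ℝ)

/-- All the quotients of reduced ranks, for finitely generated `K` with `H ≤ K ≤ G`. -/
def compressionRatios {G : Type*} [Group G] (H : Subgroup G) [Group.FG H] : Set ℝ :=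
  {q | ∃ (K : Subgroup G) (_ : Group.FG K), H ≤ K ∧ q = compressionRatio H K}

/-- The degree of compression of a finitely generated subgroup `H` in `G`. -/
noncomputable def degreeOfCompression {G : Type*} [Group G] (H : Subgroup G) [Group.FG H] : ℝ :=
  sSup (compressionRatios H)

/-- `K = A * B`: the subgroup `K` is the internal free product of its subgroups `A` and `B`, that
is, the canonical map from the abstract free product of `A` and `B` to `G` is injective, and its
image, the subgroup generated by `A` and `B`, is `K`. -/
def IsInternalFreeProduct {G : Type*} [Group G] (A B K : Subgroup G) : Prop :=
  Function.Injective (Monoid.Coprod.lift A.subtype B.subtype) ∧ A ⊔ B = K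

/-- The extension `H ≤ K` is algebraic: `H` is not contained in any proper free factor of `K`,
i.e. `H ≤ A` and `K = A * B` imply `B = 1`. -/
def IsAlgebraicExtension {G : Type*} [Group G] (H K : Subgroup G) : Prop :=
  H ≤ K ∧ ∀ A B : Subgroup G, H ≤ A → IsInternalFreeProduct A B K → B = ⊥

/-- The set of (finitely generated) algebraic extensions of `H` in `G`. -/
def algebraicExtensions {G : Type*} [Group G] (H : Subgroup G) : Set (Subgroup G) :=
  {K | Group.FG K ∧ IsAlgebraicExtension H K}

/-- The quotients of reduced ranks, for the algebraic extensions `K` of `H`. -/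
def algebraicCompressionRatios {G : Type*} [Group G] (H : Subgroup G) [Group.FG H] : Set ℝ :=
  {q | ∃ (K : Subgroup G) (_ : Group.FG K), K ∈ algebraicExtensions H ∧ q = compressionRatio H K}

/-- A word in the letters `x₁, …, xₙ` and their inverses: `(i, true)` stands for the letter of
index `i`, and `(i, false)` for its inverse. Words need not be reduced; the word `w` represents
the element `FreeGroup.mk w` of the free group. -/
abbrev Word (n : ℕ) : Type := List (Fin n × Bool)

/-- The subgroup of the free group of rank `n` generated by the elements that are represented by
the words of a finite list. -/
def generatedSubgroup {n : ℕ} (L : List (Word n)) : Subgroup (FreeGroup (Fin n)) :=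
  Subgroup.closure {g | ∃ w ∈ L, FreeGroup.mk w = g}

instance generatedSubgroup_fg {n : ℕ} (L : List (Word n)) : Group.FG (generatedSubgroup L) := by
  have h : ({g | ∃ w ∈ L, FreeGroup.mk w = g} : Set (FreeGroup (Fin n))).Finite :=
    (List.finite_toSet L).image FreeGroup.mk
  have : Finite ({g | ∃ w ∈ L, FreeGroup.mk w = g} : Set (FreeGroup (Fin n))) := h
  exact Group.closure_finite_fg _

/-- The elements represented by the words of the list `B`, each entry counted once, form a free
basis of the subgroup `K`. -/
def IsFreeBasisOf {n : ℕ} (B : List (Word n)) (K : Subgroup (FreeGroup (Fin n))) : Prop :=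
  ∃ b : FreeGroupBasis (Fin B.length) K,
    ∀ i : Fin B.length, (b i : FreeGroup (Fin n)) = FreeGroup.mk (B.get i)

end FreeCompression

open FreeCompression

namespace FreeCompression

/-! For fixed `H` the compression ratio does not decrease when the rank of `K` falls, so the degree
of compression is the ratio at an overgroup of least rank, and one exists because ranks are natural
numbers. Such a `K` is algebraic: if `K = A * B` with `H ≤ A`, then rank is additive on free
products (count homomorphisms to the group of order two), so minimality forces `B` to have rank
zero.

The rest depends on the Schreier basis of `K` for a geodesic transversal: an element of `K` is a
product of basis elements, or their inverses, that are no longer than itself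
(`IsGeodesicTransversal.mem_closure`). If `H` is generated by elements of length at most `N`, the
basis elements of length at most `N` therefore generate a free factor of `K` that contains `H`
(`exists_short_free_factor`). An algebraic extension equals this factor, which leaves finitely many
candidates; and overgroups of least rank can be sought among the subgroups generated by short words.

Containment between such subgroups is decidable by a bounded test (`covers_iff`): a set closed under
short quotients is, up to the length bound, the stabilizer of a point in a finite action, obtained
by completing partial injections to permutations. These actions also give residual finiteness, hence
the Hopf property, by which a generating list as long as the rank is a free basis. -/

/-- A relation on a finite type that is functional in both directions extends to a permutation. -/
theorem exists_perm_of_rel {V : Type*} [Finite V] (r : V → V → Prop)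
    (hl : ∀ a b c, r a b → r a c → b = c) (hr : ∀ a b c, r a c → r b c → a = b) :
    ∃ σ : Equiv.Perm V, ∀ a b, r a b → σ a = b := by
  classical
  have := Fintype.ofFinite V
  let e : {a // ∃ b, r a b} ≃ {b // ∃ a, r a b} :=
    { toFun := fun a => ⟨a.2.choose, a.1, a.2.choose_spec⟩
      invFun := fun b => ⟨b.2.choose, b.1, b.2.choose_spec⟩
      left_inv := fun a => Subtype.ext
        (hr _ _ _ (Exists.choose_spec (p := fun x => r x a.2.choose) ⟨a.1, a.2.choose_spec⟩)
          a.2.choose_spec)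
      right_inv := fun b => Subtype.ext
        (hl _ _ _ (Exists.choose_spec (p := fun x => r b.2.choose x) ⟨b.1, b.2.choose_spec⟩)
          b.2.choose_spec) }
  refine ⟨e.extendSubtype, fun a b h => ?_⟩
  rw [Equiv.extendSubtype_apply_of_mem e a ⟨b, h⟩]
  exact hl a _ _ (Exists.choose_spec (p := fun x => r a x) ⟨b, h⟩) h

/-! ### Partial subgroups, finite actions, residual finiteness and the Hopf property -/

section PartialSubgroup

universe u

variable {α : Type u} [DecidableEq α]

theorem finite_norm_le [Finite α] (N : ℕ) : {g : FreeGroup α | g.norm ≤ N}.Finite := by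
  refine Set.Finite.of_finite_image (f := FreeGroup.toWord)
    ((List.finite_length_le (α × Bool) N).subset ?_) FreeGroup.toWord_injective.injOn
  rintro _ ⟨g, hg, rfl⟩
  exact hg

/-- Every element of length at most `M₁ + M₂` is a product of elements of length at most `M₁`
and `M₂`. -/
theorem exists_mul_of_norm_le (g : FreeGroup α) (M₁ M₂ : ℕ) (h : g.norm ≤ M₁ + M₂) :
    ∃ p q : FreeGroup α, g = p * q ∧ p.norm ≤ M₁ ∧ q.norm ≤ M₂ := by
  refine ⟨FreeGroup.mk (g.toWord.take M₁), FreeGroup.mk (g.toWord.drop M₁), ?_, ?_, ?_⟩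
  · rw [FreeGroup.mul_mk, List.take_append_drop, FreeGroup.mk_toWord]
  · exact FreeGroup.norm_mk_le.trans (by simp)
  · refine FreeGroup.norm_mk_le.trans ?_
    rw [FreeGroup.norm] at h
    rw [List.length_drop]
    omega

/-- The letter of a free group, or its inverse. -/
def letter (x : α × Bool) : FreeGroup α := FreeGroup.mk [x]

omit [DecidableEq α] in
theorem letter_eq (x : α × Bool) :
    letter x = if x.2 then FreeGroup.of x.1 else (FreeGroup.of x.1)⁻¹ := by
  rcases x with ⟨i, _ | _⟩ <;> rfl

omit [DecidableEq α] in
theorem mk_cons (x : α × Bool) (l : List (α × Bool)) :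
    FreeGroup.mk (x :: l) = letter x * FreeGroup.mk l := by
  rw [letter, FreeGroup.mul_mk]; rfl

theorem norm_letter_le (x : α × Bool) : (letter x).norm ≤ 1 := FreeGroup.norm_mk_le

/-- A set of elements of a free group that contains `1` and is closed under those quotients that
have length at most `N`. -/
def IsPartialSubgroup (N : ℕ) (A : Set (FreeGroup α)) : Prop :=
  1 ∈ A ∧ ∀ a ∈ A, ∀ b ∈ A, (a⁻¹ * b).norm ≤ N → a⁻¹ * b ∈ A

theorem IsPartialSubgroup.inv_mem {N : ℕ} {A : Set (FreeGroup α)} (hA : IsPartialSubgroup N A)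
    {a : FreeGroup α} (ha : a ∈ A) (hn : a.norm ≤ N) : a⁻¹ ∈ A := by
  simpa using hA.2 a ha 1 hA.1 (by simpa using hn)

/-- The words of length at most `M`, up to the equivalence that a partial subgroup induces. -/
def partialSetoid {M : ℕ} {A : Set (FreeGroup α)} (hA : IsPartialSubgroup (2 * M) A) :
    Setoid {g : FreeGroup α // g.norm ≤ M} where
  r u v := u.1⁻¹ * v.1 ∈ A
  iseqv :=
    { refl := fun u => by simpa using hA.1
      symm := fun {u v} h => by
        have := hA.inv_mem h ((FreeGroup.norm_mul_le _ _).trans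
          (by rw [FreeGroup.norm_inv_eq]; have := u.2; have := v.2; omega))
        simpa using this
      trans := fun {u v w} h₁ h₂ => by
        have h₁' := hA.inv_mem h₁ ((FreeGroup.norm_mul_le _ _).trans
          (by rw [FreeGroup.norm_inv_eq]; have := u.2; have := v.2; omega))
        have e : (u.1⁻¹ * v.1)⁻¹⁻¹ * (v.1⁻¹ * w.1) = u.1⁻¹ * w.1 := by group
        have := hA.2 _ h₁' _ h₂
        rw [e] at this
        exact this ((FreeGroup.norm_mul_le _ _).trans
          (by rw [FreeGroup.norm_inv_eq]; have := u.2; have := w.2; omega)) }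

/-- A partial subgroup is, up to length `2 * M`, the stabilizer of a point in an action on a finite
set. -/
theorem IsPartialSubgroup.exists_action [Finite α] {M : ℕ} {A : Set (FreeGroup α)}
    (hA : IsPartialSubgroup (2 * M) A) :
    ∃ (V : Type u) (_ : Finite V) (φ : FreeGroup α →* Equiv.Perm V) (v : V),
      ∀ g : FreeGroup α, g.norm ≤ 2 * M → (φ g v = v ↔ g ∈ A) := by
  classical
  have : Finite {g : FreeGroup α // g.norm ≤ M} := finite_norm_le M
  let s := partialSetoid hA
  let V := Quotient s
  let cl : ∀ g : FreeGroup α, g.norm ≤ M → V := fun g hg => Quotient.mk s ⟨g, hg⟩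
  have hcl : ∀ g hg g' hg', cl g hg = cl g' hg' ↔ g⁻¹ * g' ∈ A := fun g hg g' hg' =>
    Quotient.eq (r := s)
  -- Left multiplication by a letter, wherever some representative stays short. It is a partial
  -- injection because multiplying `u` and `v` by the same letter leaves `u⁻¹ * v` unchanged.
  let r : α → V → V → Prop := fun i a b =>
    ∃ (u : FreeGroup α) (hu : u.norm ≤ M) (hu' : (FreeGroup.of i * u).norm ≤ M),
      cl u hu = a ∧ cl _ hu' = b
  have hσ : ∀ i, ∃ σ : Equiv.Perm V, ∀ a b, r i a b → σ a = b := by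
    intro i
    refine exists_perm_of_rel _ ?_ ?_
    · rintro _ _ _ ⟨u, hu, hu', rfl, rfl⟩ ⟨v, hv, hv', hvu, rfl⟩
      rw [hcl] at hvu
      have := hA.inv_mem hvu ((FreeGroup.norm_mul_le _ _).trans
          (by rw [FreeGroup.norm_inv_eq]; omega))
      rw [hcl]
      simpa [mul_assoc] using this
    · rintro _ _ _ ⟨u, hu, hu', rfl, rfl⟩ ⟨v, hv, hv', rfl, hvu⟩
      rw [hcl] at hvu
      have := hA.inv_mem hvu ((FreeGroup.norm_mul_le _ _).trans
          (by rw [FreeGroup.norm_inv_eq]; omega))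
      rw [hcl]
      simpa [mul_assoc] using this
  choose σ hσ using hσ
  let φ : FreeGroup α →* Equiv.Perm V := FreeGroup.lift σ
  -- Suffixes of a reduced word are reduced and no longer, so the path that starts at the class of
  -- `1` only uses values of `σ` that `r` prescribes.
  have key : ∀ (l : List (α × Bool)) (hl : FreeGroup.IsReduced l) (h : (FreeGroup.mk l).norm ≤ M),
      φ (FreeGroup.mk l) (cl 1 (by simp)) = cl _ h := by
    intro l
    induction l with
    | nil => intro _ _; exact congrArg (fun f : Equiv.Perm V => f (cl 1 (by simp))) (map_one φ)
    | cons x t ih =>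
      intro hl h
      have ht : FreeGroup.IsReduced t := List.IsChain.tail hl
      have hn : (FreeGroup.mk t).norm ≤ M := by
        rw [FreeGroup.norm, FreeGroup.toWord_mk, hl.reduce_eq] at h
        rw [FreeGroup.norm, FreeGroup.toWord_mk, ht.reduce_eq]
        simp only [List.length_cons] at h
        omega
      have h' : (letter x * FreeGroup.mk t).norm ≤ M := by rwa [← mk_cons]
      have e : cl _ h = cl _ h' := by congr 1
      rw [e, mk_cons, map_mul, Equiv.Perm.mul_apply, ih ht hn]
      rcases x with ⟨i, _ | _⟩
      · have e2 : φ (letter (i, false)) = (σ i)⁻¹ := by simp [letter_eq, φ]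
        rw [e2, Equiv.Perm.inv_eq_iff_eq]
        refine (hσ i _ _ ⟨_, h', ?_, rfl, ?_⟩).symm
        · simpa [letter_eq] using hn
        · rw [hcl, ← mul_assoc (FreeGroup.of i)]
          have : FreeGroup.of i * letter (i, false) = 1 := by simp [letter_eq]
          rw [this, one_mul, inv_mul_cancel]
          exact hA.1
      · have e2 : φ (letter (i, true)) = σ i := by simp [letter_eq, φ]
        rw [e2]
        exact hσ i _ _ ⟨_, hn, h', rfl, rfl⟩
  have key' : ∀ (g : FreeGroup α) (h : g.norm ≤ M), φ g (cl 1 (by simp)) = cl g h := by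
    intro g h
    have := key g.toWord FreeGroup.isReduced_toWord (by rwa [FreeGroup.mk_toWord])
    simpa only [FreeGroup.mk_toWord] using this
  refine ⟨V, inferInstance, φ, cl 1 (by simp), fun g hg => ?_⟩
  -- Cut in the middle: `p * q` fixes the base point exactly when `q` and `p⁻¹` send it to the same
  -- class, and both are short enough for `key'`.
  obtain ⟨p, q, rfl, hp, hq⟩ := exists_mul_of_norm_le g M M (by omega)
  have hp' : p⁻¹.norm ≤ M := by rwa [FreeGroup.norm_inv_eq]
  have hg' : (p * q)⁻¹.norm ≤ 2 * M := by rwa [FreeGroup.norm_inv_eq]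
  rw [map_mul, Equiv.Perm.mul_apply, key' q hq, ← Equiv.Perm.eq_inv_iff_eq, ← map_inv, key' _ hp',
    hcl, ← mul_inv_rev]
  exact ⟨fun h => by simpa using hA.inv_mem h hg', fun h => hA.inv_mem h hg⟩

/-- A partial subgroup `A` contains all the elements of length at most `2 * M` of the subgroup that
it generates. -/
theorem IsPartialSubgroup.mem_of_mem_closure [Finite α] {M : ℕ} {A S : Set (FreeGroup α)}
    (hA : IsPartialSubgroup (2 * M) A) (hS : S ⊆ A) (hn : ∀ g ∈ S, g.norm ≤ 2 * M)
    {g : FreeGroup α} (hg : g ∈ Subgroup.closure S) (hgn : g.norm ≤ 2 * M) : g ∈ A := by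
  obtain ⟨V, _, φ, v, hv⟩ := hA.exists_action
  rw [← hv g hgn]
  have : Subgroup.closure S ≤ (MulAction.stabilizer (Equiv.Perm V) v).comap φ := by
    rw [Subgroup.closure_le]
    intro a ha
    exact (hv a (hn a ha)).2 (hS ha)
  exact this hg

/-- Free groups of finite rank are residually finite. -/
theorem exists_finite_quotient [Finite α] {g : FreeGroup α} (hg : g ≠ 1) :
    ∃ (V : Type u) (_ : Finite V) (φ : FreeGroup α →* Equiv.Perm V), φ g ≠ 1 := by
  have hA : IsPartialSubgroup (2 * g.norm) ({1} : Set (FreeGroup α)) :=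
    ⟨rfl, by rintro _ rfl _ rfl -; simp⟩
  obtain ⟨V, hV, φ, v, hv⟩ := hA.exists_action
  refine ⟨V, hV, φ, fun h => hg ((hv g (by omega)).1 (by rw [h]; rfl))⟩

/-- Free groups of finite rank are Hopfian. -/
theorem injective_of_surjective_endomorphism [Finite α] (f : FreeGroup α →* FreeGroup α)
    (hf : Function.Surjective f) : Function.Injective f := by
  rw [injective_iff_map_eq_one]
  intro g hg
  by_contra hne
  obtain ⟨V, hV, φ, hφ⟩ := exists_finite_quotient hne
  -- Precomposition with `f` is an injective self-map of a finite set, so `φ` factors through `f`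
  -- and must kill `g`.
  have hfin : Finite (FreeGroup α →* Equiv.Perm V) := Finite.of_equiv _ FreeGroup.lift
  have hinj : Function.Injective (fun ψ : FreeGroup α →* Equiv.Perm V => ψ.comp f) :=
    fun ψ₁ ψ₂ h => (MonoidHom.cancel_right hf).1 h
  obtain ⟨ψ, hψ⟩ := Finite.surjective_of_injective hinj φ
  apply hφ
  rw [← hψ]
  simp [hg]

end PartialSubgroup

/-! ### Rank, its additivity, and overgroups of least rank -/

section Rank

variable {G : Type*} [Group G]

theorem card_fun_two (ι : Type*) [Finite ι] :
    Nat.card (ι → Multiplicative (ZMod 2)) = 2 ^ Nat.card ι := by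
  rw [Nat.card_fun, Nat.card_congr Multiplicative.toAdd, Nat.card_zmod]

/-- A homomorphism to the group with two elements is determined by its values on generators. -/
theorem finite_hom_and_card_hom_le [Group.FG G] :
    Finite (G →* Multiplicative (ZMod 2)) ∧
      Nat.card (G →* Multiplicative (ZMod 2)) ≤ 2 ^ Group.rank G := by
  obtain ⟨S, hS, hS'⟩ := Group.rank_spec G
  let res : (G →* Multiplicative (ZMod 2)) → (S → Multiplicative (ZMod 2)) := fun f s => f s
  have hres : Function.Injective res := fun f g h =>
    MonoidHom.eq_of_eqOn_dense hS' fun s hs => congrFun h ⟨s, hs⟩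
  refine ⟨Finite.of_injective res hres, (Nat.card_le_card_of_injective res hres).trans ?_⟩
  rw [card_fun_two, Nat.card_eq_fintype_card, Fintype.card_coe, hS]

/-- Homomorphisms to the group of order two are arbitrary functions on a basis, while their number
is at most two to the rank. The indicator functions embed `ι` in this finite set, so `ι` is finite
before the cardinalities are compared. -/
theorem rank_eq_card_of_basis {ι : Type*} [Group.FG G] (b : FreeGroupBasis ι G) :
    Finite ι ∧ Group.rank G = Nat.card ι := by
  classical
  obtain ⟨hfin, hcard⟩ := finite_hom_and_card_hom_le (G := G)
  have hfin' : Finite (ι → Multiplicative (ZMod 2)) := Finite.of_equiv _ b.lift.symm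
  have hι : Finite ι := by
    refine Finite.of_injective
      (fun i : ι => (Pi.mulSingle i (Multiplicative.ofAdd 1) : ι → Multiplicative (ZMod 2))) ?_
    intro i j h
    by_contra hne
    have := congrFun h i
    beta_reduce at this
    rw [Pi.mulSingle_eq_same, Pi.mulSingle_eq_of_ne hne] at this
    exact absurd this (by decide)
  have := Fintype.ofFinite ι
  refine ⟨hι, le_antisymm ?_ ?_⟩
  · have hS : Subgroup.closure ((Finset.univ.image b : Finset G) : Set G) = ⊤ := by
      have := FreeGroup.closure_range_of ι
      apply_fun Subgroup.map b.repr.symm.toMonoidHom at this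
      rw [MonoidHom.map_closure, ← Set.range_comp,
        Subgroup.map_top_of_surjective _ b.repr.symm.surjective] at this
      rw [← this]
      simp only [Finset.coe_image, Finset.coe_univ, Set.image_univ]
      congr 1
    refine (Group.rank_le hS).trans (Finset.card_image_le.trans ?_)
    simp [Nat.card_eq_fintype_card]
  · rw [← Nat.card_congr b.lift] at hcard
    rw [card_fun_two] at hcard
    exact (Nat.pow_le_pow_iff_right (by norm_num)).1 hcard

theorem card_hom_eq_two_pow_rank [Group.FG G] [IsFreeGroup G] :
    Nat.card (G →* Multiplicative (ZMod 2)) = 2 ^ Group.rank G := by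
  obtain ⟨hfin, hr⟩ := rank_eq_card_of_basis (IsFreeGroup.basis G)
  rw [hr, ← Nat.card_congr (IsFreeGroup.basis G).lift, card_fun_two]

theorem IsInternalFreeProduct.exists_mulEquiv {A B K : Subgroup G}
    (h : IsInternalFreeProduct A B K) : Nonempty (Monoid.Coprod A B ≃* K) := by
  refine ⟨(MonoidHom.ofInjective h.1).trans (MulEquiv.subgroupCongr ?_)⟩
  rw [Monoid.Coprod.range_lift, Subgroup.range_subtype, Subgroup.range_subtype, h.2]

theorem IsInternalFreeProduct.fg {A B K : Subgroup G} (h : IsInternalFreeProduct A B K)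
    [Group.FG K] : Group.FG A ∧ Group.FG B := by
  obtain ⟨e⟩ := h.exists_mulEquiv
  exact ⟨Group.fg_of_surjective (f := Monoid.Coprod.fst.comp e.symm.toMonoidHom)
      (Monoid.Coprod.fst_surjective.comp e.symm.surjective),
    Group.fg_of_surjective (f := Monoid.Coprod.snd.comp e.symm.toMonoidHom)
      (Monoid.Coprod.snd_surjective.comp e.symm.surjective)⟩

/-- In a free group, the rank is additive on free products of subgroups. -/
theorem IsInternalFreeProduct.rank_add [IsFreeGroup G] {A B K : Subgroup G}
    (h : IsInternalFreeProduct A B K) [Group.FG A] [Group.FG B] [Group.FG K] :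
    Group.rank A + Group.rank B = Group.rank K := by
  obtain ⟨e⟩ := h.exists_mulEquiv
  have e' : (A →* Multiplicative (ZMod 2)) × (B →* Multiplicative (ZMod 2)) ≃
      (K →* Multiplicative (ZMod 2)) :=
    Monoid.Coprod.liftEquiv.trans e.monoidHomCongrLeftEquiv
  have hc := Nat.card_congr e'
  rw [Nat.card_prod, card_hom_eq_two_pow_rank, card_hom_eq_two_pow_rank, card_hom_eq_two_pow_rank,
    ← pow_add] at hc
  exact Nat.pow_right_injective le_rfl hc

/-- A generating family of a free group with as many members as the rank is a free basis. -/
theorem exists_basis_of_card_eq_rank [Group.FG G] [IsFreeGroup G] {k : ℕ} (s : Fin k → G)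
    (hs : Subgroup.closure (Set.range s) = ⊤) (hk : k = Group.rank G) :
    ∃ b : FreeGroupBasis (Fin k) G, ∀ i, b i = s i := by
  obtain ⟨hfin, hr⟩ := rank_eq_card_of_basis (IsFreeGroup.basis G)
  have e : IsFreeGroup.Generators G ≃ Fin k := Finite.equivFinOfCardEq (by rw [hk, hr])
  let b := (IsFreeGroup.basis G).reindex e
  have hsurj : Function.Surjective (FreeGroup.lift s) :=
    FreeGroup.lift_surjective_iff_closure_range_eq_top.2 hs
  have hinj : Function.Injective (FreeGroup.lift s) := by
    have := injective_of_surjective_endomorphism (b.repr.toMonoidHom.comp (FreeGroup.lift s))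
      (b.repr.surjective.comp hsurj)
    exact Function.Injective.of_comp (f := b.repr) this
  refine ⟨FreeGroupBasis.ofRepr (MulEquiv.ofBijective _ ⟨hinj, hsurj⟩).symm, fun i => ?_⟩
  change (MulEquiv.ofBijective (FreeGroup.lift s) ⟨hinj, hsurj⟩).symm.symm (FreeGroup.of i) = s i
  exact FreeGroup.lift_apply_of

/-- A finitely generated subgroup of least rank that contains `H` is an algebraic extension. -/
theorem mem_algebraicExtensions_of_rank_le [IsFreeGroup G] {H K : Subgroup G} [Group.FG K]
    (hHK : H ≤ K)
    (hmin : ∀ (K' : Subgroup G) [Group.FG K'], H ≤ K' → Group.rank K ≤ Group.rank K') :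
    K ∈ algebraicExtensions H := by
  refine ⟨inferInstance, hHK, fun A B hA h => ?_⟩
  obtain ⟨_, _⟩ := h.fg
  have h₁ := h.rank_add
  have h₂ := hmin A hA
  have h₃ : Group.rank B = 0 := by omega
  rw [Group.rank_eq_zero_iff] at h₃
  exact Subgroup.eq_bot_of_subsingleton B

theorem exists_rank_minimal (H : Subgroup G) [Group.FG H] :
    ∃ (K : Subgroup G) (_ : Group.FG K), H ≤ K ∧
      ∀ (K' : Subgroup G) [Group.FG K'], H ≤ K' → Group.rank K ≤ Group.rank K' := by
  classical
  have hex : ∃ r, ∃ (K : Subgroup G) (_ : Group.FG K), H ≤ K ∧ Group.rank K = r :=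
    ⟨_, H, inferInstance, le_rfl, rfl⟩
  obtain ⟨K, hK, hHK, hr⟩ := Nat.find_spec hex
  exact ⟨K, hK, hHK, fun K' _ h => hr.trans_le (Nat.find_min' hex ⟨K', inferInstance, h, rfl⟩)⟩

theorem rank_le_one_of_isCyclic [Group.FG G] [IsCyclic G] : Group.rank G ≤ 1 := by
  obtain ⟨g, hg⟩ := IsCyclic.exists_generator (α := G)
  have : Subgroup.closure (({g} : Finset G) : Set G) = ⊤ := by
    rw [Finset.coe_singleton, ← Subgroup.zpowers_eq_closure, Subgroup.eq_top_iff']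
    exact hg
  exact Group.rank_le this

theorem isCyclic_of_rank_le_one [Group.FG G] (h : Group.rank G ≤ 1) : IsCyclic G := by
  obtain ⟨S, hS, hS'⟩ := Group.rank_spec G
  obtain ⟨g, hg⟩ := Finset.card_le_one_iff_subset_singleton.1 (hS.trans_le h)
  refine ⟨g, fun x => ?_⟩
  have : Subgroup.closure (S : Set G) ≤ Subgroup.zpowers g := by
    rw [Subgroup.closure_le]
    intro y hy
    rw [Finset.mem_singleton.1 (hg hy)]
    exact Subgroup.mem_zpowers g
  exact this (hS' ▸ Subgroup.mem_top x)

/-- Subgroups of cyclic groups are cyclic. This excludes a positive reduced rank over a zero one,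
which real division would evaluate to `0`. -/
theorem rank_le_one_of_le {H K : Subgroup G} [Group.FG H] [Group.FG K] (h : H ≤ K)
    (hK : Group.rank K ≤ 1) : Group.rank H ≤ 1 := by
  have := isCyclic_of_rank_le_one hK
  have : IsCyclic H := isCyclic_of_injective (Subgroup.inclusion h) (Subgroup.inclusion_injective h)
  exact rank_le_one_of_isCyclic

/-- The compression ratio is greatest at the extensions of least rank. -/
theorem isGreatest_compressionRatio {H K : Subgroup G} [Group.FG H] [Group.FG K] (hHK : H ≤ K)
    (hmin : ∀ (K' : Subgroup G) [Group.FG K'], H ≤ K' → Group.rank K ≤ Group.rank K') :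
    IsGreatest (compressionRatios H) (compressionRatio H K) := by
  refine ⟨⟨K, inferInstance, hHK, rfl⟩, ?_⟩
  rintro _ ⟨K', _, hK', rfl⟩
  have h := hmin K' hK'
  have hH := hmin H le_rfl
  have hone := rank_le_one_of_le hHK
  unfold compressionRatio reducedRank
  split_ifs with h₁ h₂ h₂
  · exact le_rfl
  · have : Group.rank K - 1 = 0 := by omega
    exact absurd ⟨h₁.1, this⟩ h₂
  · simp [h₂.1]
  · by_cases hz : Group.rank H - 1 = 0
    · simp [hz]
    · have hpos : 0 < Group.rank K - 1 := by
        by_contra hK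
        have := hone (by omega)
        omega
      gcongr

theorem degreeOfCompression_eq {H K : Subgroup G} [Group.FG H] [Group.FG K] (hHK : H ≤ K)
    (hmin : ∀ (K' : Subgroup G) [Group.FG K'], H ≤ K' → Group.rank K ≤ Group.rank K') :
    degreeOfCompression H = compressionRatio H K :=
  (isGreatest_compressionRatio hHK hmin).csSup_eq

end Rank

/-! ### Free factors spanned by part of a basis -/

section FreeFactor

variable {G : Type*} [Group G] {K : Subgroup G} {ι : Type*}

theorem closure_range_of_basis (b : FreeGroupBasis ι K) :
    Subgroup.closure (Set.range fun i => (b i : G)) = K := by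
  have : (K.subtype.comp b.repr.symm.toMonoidHom).range = K := by
    rw [MonoidHom.range_comp, MonoidHom.range_eq_top.2 b.repr.symm.surjective,
      ← MonoidHom.range_eq_map, Subgroup.range_subtype]
  conv_rhs => rw [← this, MonoidHom.range_eq_map, ← FreeGroup.closure_range_of,
    MonoidHom.map_closure, ← Set.range_comp]
  rfl

/-- Part of a free basis generates a free factor. -/
theorem isInternalFreeProduct_of_basis (b : FreeGroupBasis ι K) (p : Set ι) :
    IsInternalFreeProduct (Subgroup.closure ((fun i => (b i : G)) '' p))
      (Subgroup.closure ((fun i => (b i : G)) '' pᶜ)) K := by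
  classical
  set A := Subgroup.closure ((fun i => (b i : G)) '' p) with hA
  set B := Subgroup.closure ((fun i => (b i : G)) '' pᶜ) with hB
  have hsup : A ⊔ B = K := by
    rw [hA, hB, ← Subgroup.closure_union, ← Set.image_union, Set.union_compl_self, Set.image_univ,
      closure_range_of_basis]
  have hAK : A ≤ K := hsup ▸ le_sup_left
  have hBK : B ≤ K := hsup ▸ le_sup_right
  refine ⟨?_, hsup⟩
  let φ : Monoid.Coprod A B →* K :=
    Monoid.Coprod.lift (Subgroup.inclusion hAK) (Subgroup.inclusion hBK)
  have hφ : Monoid.Coprod.lift A.subtype B.subtype = K.subtype.comp φ :=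
    Monoid.Coprod.hom_ext rfl rfl
  -- A left inverse of `φ`: each basis element goes to the factor on whose side of `p` it lies.
  let θ : K →* Monoid.Coprod A B := b.lift fun i =>
    if h : i ∈ p then Monoid.Coprod.inl ⟨b i, Subgroup.subset_closure ⟨i, h, rfl⟩⟩
    else Monoid.Coprod.inr ⟨b i, Subgroup.subset_closure ⟨i, h, rfl⟩⟩
  have hθ : ∀ i, θ (b i) = _ := fun i => congrFun (b.lift.symm_apply_apply _) i
  have hid : θ.comp φ = MonoidHom.id _ := by
    refine Monoid.Coprod.hom_ext ?_ ?_
    · refine MonoidHom.eq_of_eqOn_dense Subgroup.closure_closure_coe_preimage ?_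
      rintro ⟨_, _⟩ ⟨i, hi, rfl⟩
      have := hθ i
      rw [dif_pos hi] at this
      exact this
    · refine MonoidHom.eq_of_eqOn_dense Subgroup.closure_closure_coe_preimage ?_
      rintro ⟨_, _⟩ ⟨i, hi, rfl⟩
      have := hθ i
      rw [dif_neg hi] at this
      exact this
  rw [hφ, MonoidHom.coe_comp]
  refine K.subtype_injective.comp (Function.LeftInverse.injective (g := θ) fun x => ?_)
  exact DFunLike.congr_fun hid x

/-- Part of a free basis has as many elements as the rank of the subgroup that it generates. -/
theorem ncard_image_basis_eq_rank (b : FreeGroupBasis ι K) (p : Set ι)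
    [Group.FG (Subgroup.closure ((fun i => (b i : G)) '' p))] :
    ((fun i => (b i : G)) '' p).ncard =
      Group.rank (Subgroup.closure ((fun i => (b i : G)) '' p)) := by
  let f : FreeGroup p →* G := (K.subtype.comp b.repr.symm.toMonoidHom).comp
    (FreeGroup.map Subtype.val)
  have hf : Function.Injective f :=
    (K.subtype_injective.comp b.repr.symm.injective).comp
      (FreeGroup.map_injective Subtype.val_injective)
  have hrange : f.range = Subgroup.closure ((fun i => (b i : G)) '' p) := by
    rw [MonoidHom.range_comp, FreeGroup.range_map, MonoidHom.map_closure, Subtype.range_coe,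
      Set.image_image]
    rfl
  have hb : FreeGroupBasis p (Subgroup.closure ((fun i => (b i : G)) '' p)) :=
    FreeGroupBasis.ofRepr ((MonoidHom.ofInjective hf).trans (MulEquiv.subgroupCongr hrange)).symm
  rw [(rank_eq_card_of_basis hb).2, Set.ncard_image_of_injective, Nat.card_coe_set_eq]
  exact Subtype.val_injective.comp b.injective

end FreeFactor

/-! ### Geodesic transversals and Schreier bases -/

section Schreier

universe u

variable {α : Type u} [DecidableEq α] (K : Subgroup (FreeGroup α))

/-- Representatives of least length of the left cosets that are closed under removing the first
letter. -/
structure IsGeodesicTransversal (t : FreeGroup α ⧸ K → FreeGroup α) : Prop where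
  mk_eq : ∀ c, (t c : FreeGroup α ⧸ K) = c
  norm_le : ∀ g : FreeGroup α, (t g).norm ≤ g.norm
  step : ∀ c, t c = 1 ∨ ∃ (y : α × Bool) (c' : FreeGroup α ⧸ K),
    (t c').norm < (t c).norm ∧ t c = letter y * t c'

/-- Deleting the first letter of a shortest representative lowers the distance of the coset by
exactly one. Choosing one such neighbour per coset and following the choices gives coherent
representatives. -/
theorem exists_isGeodesicTransversal : ∃ t, IsGeodesicTransversal K t := by
  classical
  have hex : ∀ c : FreeGroup α ⧸ K, ∃ k, ∃ g : FreeGroup α, (g : FreeGroup α ⧸ K) = c ∧ g.norm = k :=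
    fun c => by
      obtain ⟨g, rfl⟩ := QuotientGroup.mk_surjective c
      exact ⟨_, g, rfl, rfl⟩
  let d : FreeGroup α ⧸ K → ℕ := fun c => Nat.find (hex c)
  have hd : ∀ g : FreeGroup α, d g ≤ g.norm := fun g => Nat.find_min' (hex g) ⟨g, rfl, rfl⟩
  have hd' : ∀ c, ∃ g : FreeGroup α, (g : FreeGroup α ⧸ K) = c ∧ g.norm = d c :=
    fun c => Nat.find_spec (hex c)
  -- At distance zero `z` is the dummy value `1`, since there need not be any letter; the bound on
  -- its length holds in all cases.
  have hstep : ∀ c, ∃ (z : FreeGroup α) (c' : FreeGroup α ⧸ K), z.norm ≤ 1 ∧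
      (d c ≠ 0 → (∃ y, z = letter y) ∧ z • c' = c ∧ d c = d c' + 1) := by
    intro c
    obtain ⟨g, rfl, hg⟩ := hd' c
    cases hw : g.toWord with
    | nil =>
      rw [FreeGroup.norm, hw] at hg
      exact ⟨1, g, by simp, fun h => absurd hg.symm h⟩
    | cons y l =>
      refine ⟨letter y, (FreeGroup.mk l : FreeGroup α), norm_letter_le y, fun _ => ⟨⟨y, rfl⟩, ?_⟩⟩
      have e : letter y * FreeGroup.mk l = g := by
        rw [← mk_cons, ← hw, FreeGroup.mk_toWord]
      have e' : letter y • ((FreeGroup.mk l : FreeGroup α) : FreeGroup α ⧸ K) = g := by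
        rw [← e]; rfl
      refine ⟨e', ?_⟩
      rw [FreeGroup.norm, hw, List.length_cons] at hg
      have h₁ := (hd (FreeGroup.mk l)).trans FreeGroup.norm_mk_le
      obtain ⟨g', hg', hn'⟩ := hd' (FreeGroup.mk l : FreeGroup α)
      have h₂ : d g ≤ (letter y * g').norm := by
        rw [← e', ← hg']; exact hd _
      have h₃ := h₂.trans (FreeGroup.norm_mul_le _ _)
      have h₄ := norm_letter_le y
      omega
  choose z nxt hz hy using hstep
  let u : ℕ → FreeGroup α ⧸ K → FreeGroup α := fun k =>
    Nat.rec (fun _ => 1) (fun _ ih c => z c * ih (nxt c)) k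
  have hu : ∀ k c, (u k c).norm ≤ k ∧ (d c = k → QuotientGroup.mk (s := K) (u k c) = c) := by
    intro k
    induction k with
    | zero =>
      refine fun c => ⟨by simp [u], fun h => ?_⟩
      obtain ⟨g, rfl, hg⟩ := hd' c
      rw [h, FreeGroup.norm_eq_zero] at hg
      rw [hg]
      rfl
    | succ k ih =>
      refine fun c => ⟨(FreeGroup.norm_mul_le _ _).trans ?_, fun h => ?_⟩
      · have := hz c
        have := (ih (nxt c)).1
        change _ + (u k (nxt c)).norm ≤ _
        omega
      · obtain ⟨-, h₁, h₂⟩ := hy c (by omega)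
        conv_rhs => rw [← h₁, ← (ih (nxt c)).2 (by omega)]
        rfl
  have hn : ∀ c, (u (d c) c).norm = d c := fun c =>
    le_antisymm (hu _ c).1 (by conv_lhs => rw [← (hu (d c) c).2 rfl]
                               exact hd _)
  refine ⟨fun c => u (d c) c, fun c => (hu (d c) c).2 rfl, fun g => (hn _).trans_le (hd g),
    fun c => ?_⟩
  by_cases h : d c = 0
  · left
    rw [h]
    rfl
  · right
    obtain ⟨⟨y, hzy⟩, -, hd₁⟩ := hy c h
    refine ⟨y, nxt c, ?_, ?_⟩
    · rw [hn, hn]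
      omega
    · rw [hd₁, ← hzy]

variable {K}

/-- The Schreier generator of an edge of the graph of cosets. -/
def schreierGenerator (t : FreeGroup α ⧸ K → FreeGroup α) (e : (FreeGroup α ⧸ K) × α) :
    FreeGroup α :=
  (t (FreeGroup.of e.2 • e.1))⁻¹ * FreeGroup.of e.2 * t e.1

variable {t : FreeGroup α ⧸ K → FreeGroup α} (ht : IsGeodesicTransversal K t)

include ht

theorem IsGeodesicTransversal.one : t (1 : FreeGroup α) = 1 := by
  have := ht.norm_le 1
  rwa [FreeGroup.norm_one, Nat.le_zero, FreeGroup.norm_eq_zero] at this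

theorem IsGeodesicTransversal.schreierGenerator_mem (e : (FreeGroup α ⧸ K) × α) :
    schreierGenerator t e ∈ K := by
  rw [schreierGenerator, mul_assoc, ← QuotientGroup.eq, ht.mk_eq]
  conv_lhs => rw [← ht.mk_eq e.1]
  rfl

/-- An element of `K` is a product of Schreier generators that are not longer than it. -/
theorem IsGeodesicTransversal.mem_closure {h : FreeGroup α} (hh : h ∈ K) :
    h ∈ Subgroup.closure {g | g.norm ≤ h.norm ∧ ∃ e, schreierGenerator t e = g} := by
  set C := Subgroup.closure {g | g.norm ≤ h.norm ∧ ∃ e, schreierGenerator t e = g} with hC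
  have key : ∀ b a : List (α × Bool), a ++ b = h.toWord →
      (t (FreeGroup.mk b : FreeGroup α))⁻¹ * FreeGroup.mk b ∈ C := by
    intro b
    induction b with
    | nil =>
      intro _ _
      change (t (1 : FreeGroup α))⁻¹ * 1 ∈ C
      rw [ht.one]
      simp
    | cons x b ih =>
      intro a hab
      have h₁ := ih (a ++ [x]) (by simpa using hab)
      have hlen : h.norm = a.length + (b.length + 1) := by
        rw [FreeGroup.norm, ← hab, List.length_append, List.length_cons]
      have hb : (t (FreeGroup.mk b : FreeGroup α)).norm ≤ b.length :=
        (ht.norm_le _).trans FreeGroup.norm_mk_le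
      -- As `h ∈ K`, the suffix `x :: b` lies in the coset of the inverse of the prefix `a`. The
      -- Schreier generator of this edge thus has length at most `a.length + 1 + b.length`, the
      -- length of `h`.
      have hxb : (t (FreeGroup.mk (x :: b) : FreeGroup α)).norm ≤ a.length := by
        have e : ((FreeGroup.mk (x :: b) : FreeGroup α) : FreeGroup α ⧸ K) =
            ((FreeGroup.mk a)⁻¹ : FreeGroup α) := by
          rw [QuotientGroup.eq, ← mul_inv_rev, FreeGroup.mul_mk, hab, FreeGroup.mk_toWord]
          exact K.inv_mem hh
        rw [e]
        refine (ht.norm_le _).trans ?_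
        rw [FreeGroup.norm_inv_eq]
        exact FreeGroup.norm_mk_le
      have hs : (t (FreeGroup.mk (x :: b) : FreeGroup α))⁻¹ * letter x *
          t (FreeGroup.mk b : FreeGroup α) ∈ C := by
        have hn : ((t (FreeGroup.mk (x :: b) : FreeGroup α))⁻¹ * letter x *
            t (FreeGroup.mk b : FreeGroup α)).norm ≤ h.norm := by
          refine (FreeGroup.norm_mul_le _ _).trans ?_
          have h₂ := FreeGroup.norm_mul_le (t (FreeGroup.mk (x :: b) : FreeGroup α))⁻¹ (letter x)
          rw [FreeGroup.norm_inv_eq] at h₂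
          have := norm_letter_le x
          omega
        rcases x with ⟨i, _ | _⟩
        · rw [← inv_mem_iff]
          refine Subgroup.subset_closure ⟨by rwa [FreeGroup.norm_inv_eq],
            ((FreeGroup.mk ((i, false) :: b) : FreeGroup α), i), ?_⟩
          have e : FreeGroup.of i • ((FreeGroup.mk ((i, false) :: b) : FreeGroup α) :
              FreeGroup α ⧸ K) = (FreeGroup.mk b : FreeGroup α) := by
            change ((FreeGroup.of i * FreeGroup.mk ((i, false) :: b) : FreeGroup α) :
              FreeGroup α ⧸ K) = _
            rw [mk_cons, letter_eq]
            simp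
          simp only [schreierGenerator, e, letter_eq]
          simp [mul_assoc]
        · refine Subgroup.subset_closure ⟨hn, ((FreeGroup.mk b : FreeGroup α), i), ?_⟩
          rfl
      have := C.mul_mem hs h₁
      rw [mk_cons x b] at this ⊢
      simpa [mul_assoc] using this
  have := key h.toWord [] rfl
  rw [FreeGroup.mk_toWord] at this
  have e : (h : FreeGroup α ⧸ K) = (1 : FreeGroup α) := by
    rw [eq_comm, QuotientGroup.eq]; simpa using hh
  rw [e, ht.one] at this
  simpa using this

open Classical in
/-- The nontrivial Schreier generators of a geodesic transversal form a free basis. -/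
theorem IsGeodesicTransversal.exists_basis :
    ∃ b : FreeGroupBasis {e : (FreeGroup α ⧸ K) × α // schreierGenerator t e ≠ 1} K,
      ∀ e, (b e : FreeGroup α) = schreierGenerator t e := by
  let E := {e : (FreeGroup α ⧸ K) × α // schreierGenerator t e ≠ 1}
  let lab : (FreeGroup α ⧸ K) × α → FreeGroup E := fun e =>
    if h : schreierGenerator t e ≠ 1 then FreeGroup.of ⟨e, h⟩ else 1
  -- The action on cosets, with a second coordinate that collects edge labels on the left and so
  -- commutes with right multiplication.
  let π : α → Equiv.Perm ((FreeGroup α ⧸ K) × FreeGroup E) := fun i =>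
    { toFun := fun p => (FreeGroup.of i • p.1, lab (p.1, i) * p.2)
      invFun := fun p => ((FreeGroup.of i)⁻¹ • p.1, (lab ((FreeGroup.of i)⁻¹ • p.1, i))⁻¹ * p.2)
      left_inv := fun p => by simp
      right_inv := fun p => by simp }
  let Φ : FreeGroup α →* Equiv.Perm ((FreeGroup α ⧸ K) × FreeGroup E) := FreeGroup.lift π
  have hΦof : ∀ i p, Φ (FreeGroup.of i) p = (FreeGroup.of i • p.1, lab (p.1, i) * p.2) := by
    intro i p
    simp only [Φ, FreeGroup.lift_apply_of]
    rfl
  have hΦinv : ∀ i p, Φ (FreeGroup.of i)⁻¹ p =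
      ((FreeGroup.of i)⁻¹ • p.1, (lab ((FreeGroup.of i)⁻¹ • p.1, i))⁻¹ * p.2) := by
    intro i p
    rw [map_inv]
    simp only [Φ, FreeGroup.lift_apply_of]
    rfl
  have hΦ : ∀ g c w, Φ g (c, w) = (g • c, (Φ g (c, 1)).2 * w) := by
    intro g
    induction g using FreeGroup.induction_on with
    | C1 => intro c w; simp
    | of i => intro c w; simp [hΦof]
    | inv_of i _ => intro c w; rw [hΦinv, hΦinv]; simp
    | mul x y hx hy =>
      intro c w
      rw [map_mul, Equiv.Perm.mul_apply, Equiv.Perm.mul_apply, hy c w, hx, hy c 1]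
      conv_rhs => rw [hx]
      simp [mul_smul, mul_assoc]
  have hk : ∀ k : K, (k : FreeGroup α) • ((1 : FreeGroup α) : FreeGroup α ⧸ K) =
      (1 : FreeGroup α) := by
    intro k
    change ((k.1 * 1 : FreeGroup α) : FreeGroup α ⧸ K) = _
    rw [eq_comm, QuotientGroup.eq]
    simp
  -- Elements of `K` fix the base coset, so the label collected from there is multiplicative; `ρ`
  -- will invert `ψ`.
  let ρ : K →* FreeGroup E := MonoidHom.mk' (fun k => (Φ k ((1 : FreeGroup α), 1)).2) <| by
    intro g k
    rw [Subgroup.coe_mul, map_mul, Equiv.Perm.mul_apply, hΦ k, hk, hΦ g]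
  -- The edges along a representative have trivial Schreier generators, so they contribute no label.
  have htree : ∀ (m : ℕ) c, (t c).norm = m →
      Φ (t c) ((1 : FreeGroup α), 1) = (c, 1) := by
    intro m
    induction m using Nat.strong_induction_on with
    | _ m ih =>
      intro c hc
      rcases ht.step c with h | ⟨y, c', hlt, hy⟩
      · have : c = (1 : FreeGroup α) := by rw [← ht.mk_eq c, h]
        rw [h, map_one, this]
        rfl
      · have hc' : c = letter y • c' := by
          rw [← ht.mk_eq c, hy]
          conv_rhs => rw [← ht.mk_eq c']
          rfl
        rw [hy, map_mul, Equiv.Perm.mul_apply, ih _ (hc ▸ hlt) c' rfl]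
        rcases y with ⟨i, _ | _⟩
        · have e : letter (i, false) = (FreeGroup.of i)⁻¹ := rfl
          have e1 : schreierGenerator t (c, i) = 1 := by
            rw [schreierGenerator]
            have : FreeGroup.of i • c = c' := by rw [hc', e, smul_inv_smul]
            simp only [this, hy, e]
            group
          rw [e, hΦinv]
          rw [e] at hc'
          simp only [← hc']
          have : lab (c, i) = 1 := dif_neg (not_not.2 e1)
          rw [this]
          simp
        · have e : letter (i, true) = FreeGroup.of i := rfl
          rw [e] at hc' hy ⊢
          have e1 : schreierGenerator t (c', i) = 1 := by
            rw [schreierGenerator]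
            simp only [← hc', hy]
            group
          rw [hΦof]
          simp only [← hc']
          have : lab (c', i) = 1 := dif_neg (not_not.2 e1)
          rw [this]
          simp
  let ψ : FreeGroup E →* K := FreeGroup.lift fun e =>
    ⟨schreierGenerator t e, ht.schreierGenerator_mem e⟩
  have hψ : ∀ e : E, (ψ (FreeGroup.of e) : FreeGroup α) = schreierGenerator t e := fun e => by
    simp [ψ]
  have hρψ : ρ.comp ψ = MonoidHom.id _ := by
    refine FreeGroup.ext_hom _ _ fun e => ?_
    change (Φ (ψ (FreeGroup.of e) : FreeGroup α) ((1 : FreeGroup α), 1)).2 = FreeGroup.of e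
    rw [hψ, schreierGenerator, map_mul, map_mul, Equiv.Perm.mul_apply, Equiv.Perm.mul_apply,
      htree _ _ rfl, hΦof, mul_one]
    have h₁ := hΦ (t (FreeGroup.of e.1.2 • e.1.1)) (1 : FreeGroup α) (lab e.1)
    rw [htree _ _ rfl, one_mul] at h₁
    have h₂ : (t (FreeGroup.of e.1.2 • e.1.1)) • ((1 : FreeGroup α) : FreeGroup α ⧸ K) =
        FreeGroup.of e.1.2 • e.1.1 := by
      conv_rhs => rw [← ht.mk_eq (FreeGroup.of e.1.2 • e.1.1)]
      change ((_ * 1 : FreeGroup α) : FreeGroup α ⧸ K) = _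
      rw [mul_one]
    rw [h₂] at h₁
    have h₃ : lab e.1 = FreeGroup.of e := dif_pos e.2
    rw [map_inv]
    change ((Φ (t (FreeGroup.of e.1.2 • e.1.1)))⁻¹ (FreeGroup.of e.1.2 • e.1.1, lab e.1)).2 = _
    rw [← h₁, Equiv.Perm.inv_def, Equiv.symm_apply_apply]
    exact h₃
  have hinj : Function.Injective ψ :=
    Function.LeftInverse.injective (g := ρ) fun x => DFunLike.congr_fun hρψ x
  have hsurj : Function.Surjective ψ := by
    have : Subgroup.map K.subtype ψ.range = K := by
      refine le_antisymm ((Subgroup.map_mono le_top).trans ?_) fun h hh => ?_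
      · rw [← MonoidHom.range_eq_map, Subgroup.range_subtype]
      · refine (Subgroup.closure_le _).2 ?_ (ht.mem_closure hh)
        rintro _ ⟨-, e, rfl⟩
        by_cases he : schreierGenerator t e = 1
        · rw [he]; exact one_mem _
        · exact ⟨ψ (FreeGroup.of ⟨e, he⟩), ⟨_, rfl⟩, hψ ⟨e, he⟩⟩
    intro k
    have hk : (k : FreeGroup α) ∈ Subgroup.map K.subtype ψ.range := this.symm ▸ k.2
    obtain ⟨_, ⟨x, rfl⟩, hx⟩ := hk
    exact ⟨x, Subtype.ext hx⟩
  refine ⟨FreeGroupBasis.ofRepr (MulEquiv.ofBijective ψ ⟨hinj, hsurj⟩).symm, fun e => ?_⟩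
  exact hψ e

omit ht

/-- If `H` is generated by elements of length at most `N`, then `H` is contained in a free factor
of `K` with a free basis of elements of length at most `N`. -/
theorem exists_short_free_factor {H : Subgroup (FreeGroup α)} {S : Set (FreeGroup α)} {N : ℕ}
    (hSH : Subgroup.closure S = H) (hN : ∀ g ∈ S, g.norm ≤ N) (hHK : H ≤ K) :
    ∃ T : Set (FreeGroup α), (∀ g ∈ T, g.norm ≤ N) ∧ H ≤ Subgroup.closure T ∧
      (∃ B, IsInternalFreeProduct (Subgroup.closure T) B K) ∧
      ∀ [Group.FG (Subgroup.closure T)], T.ncard = Group.rank (Subgroup.closure T) := by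
  obtain ⟨t, ht⟩ := exists_isGeodesicTransversal K
  obtain ⟨b, hb⟩ := ht.exists_basis
  refine ⟨(fun e => (b e : FreeGroup α)) '' {e | (b e : FreeGroup α).norm ≤ N}, ?_, ?_,
    ⟨_, isInternalFreeProduct_of_basis b _⟩, ncard_image_basis_eq_rank b _⟩
  · rintro _ ⟨e, he, rfl⟩
    exact he
  · rw [← hSH, Subgroup.closure_le]
    intro g hg
    have hgK : g ∈ K := hHK (hSH ▸ Subgroup.subset_closure hg)
    refine (Subgroup.closure_le _).2 ?_ (ht.mem_closure hgK)
    rintro _ ⟨hn, e, rfl⟩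
    by_cases he : schreierGenerator t e = 1
    · rw [he]; exact one_mem _
    · refine Subgroup.subset_closure ⟨⟨e, he⟩, ?_, hb _⟩
      rw [Set.mem_ofPred_eq, hb]
      exact hn.trans (hN g hg)

end Schreier

/-! ### Finiteness of the set of algebraic extensions -/

/-- **Takahasi's theorem**: a finitely generated subgroup of a free group of finite rank has only
finitely many algebraic extensions. -/
theorem finite_algebraicExtensions {α : Type*} [Finite α] (H : Subgroup (FreeGroup α))
    [Group.FG H] : (algebraicExtensions H).Finite := by
  classical
  obtain ⟨S, hS⟩ := (Group.fg_iff_subgroup_fg H).1 inferInstance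
  have hN : ∀ g ∈ (S : Set (FreeGroup α)), g.norm ≤ S.sup FreeGroup.norm := fun g hg =>
    Finset.le_sup (f := FreeGroup.norm) hg
  refine (((finite_norm_le (α := α) (S.sup FreeGroup.norm)).finite_subsets).image
    Subgroup.closure).subset ?_
  rintro K ⟨hK, hHK, halg⟩
  -- Algebraicity kills the complement `B`, so `K` is generated by a subset of the finite ball.
  obtain ⟨T, hT, hHT, ⟨B, hB⟩, -⟩ := exists_short_free_factor hS hN hHK
  refine ⟨T, hT, ?_⟩
  have := hB.2
  rwa [halg _ B hHT hB, sup_bot_eq] at this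

/-! ### Bounded search among lists of short words -/

section Words

variable {n : ℕ}

/-- All the words of length at most `N`. -/
noncomputable def wordsUpTo (n : ℕ) : ℕ → List (Word n)
  | 0 => [[]]
  | N + 1 => [] :: (Finset.univ : Finset (Fin n × Bool)).toList.flatMap
      fun x => (wordsUpTo n N).map (List.cons x)

theorem mem_wordsUpTo {N : ℕ} {w : Word n} : w ∈ wordsUpTo n N ↔ w.length ≤ N := by
  induction N generalizing w with
  | zero => simp [wordsUpTo]
  | succ N ih => cases w <;> simp [wordsUpTo, ih]

theorem nodup_wordsUpTo (N : ℕ) : (wordsUpTo n N).Nodup := by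
  induction N with
  | zero => simp [wordsUpTo]
  | succ N ih =>
    rw [wordsUpTo, List.nodup_cons, List.nodup_flatMap]
    refine ⟨by simp, fun x _ => ih.map (List.cons_injective), ?_⟩
    refine (Finset.nodup_toList _).imp fun {x y} hxy => ?_
    intro w hx hy
    simp only [List.mem_map] at hx hy
    obtain ⟨_, -, rfl⟩ := hx
    obtain ⟨_, -, h⟩ := hy
    exact hxy (List.cons.inj h).1.symm

/-- A finite set of short elements is represented by a sublist of the list of short words. -/
theorem exists_sublist_wordsUpTo {N : ℕ} {T : Set (FreeGroup (Fin n))}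
    (hT : ∀ g ∈ T, g.norm ≤ N) :
    ∃ S ∈ (wordsUpTo n N).sublists', generatedSubgroup S = Subgroup.closure T ∧
      S.length = T.ncard := by
  classical
  let S := (wordsUpTo n N).filter fun w => w ∈ FreeGroup.toWord '' T
  have hS : ∀ w, w ∈ S ↔ w ∈ FreeGroup.toWord '' T := by
    intro w
    simp only [S, List.mem_filter, decide_eq_true_eq, and_iff_right_iff_imp, mem_wordsUpTo]
    rintro ⟨g, hg, rfl⟩
    exact hT g hg
  refine ⟨S, List.mem_sublists'.2 List.filter_sublist, ?_, ?_⟩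
  · rw [generatedSubgroup]
    congr 1
    ext g
    constructor
    · rintro ⟨w, hw, rfl⟩
      obtain ⟨g, hg, rfl⟩ := (hS w).1 hw
      rwa [FreeGroup.mk_toWord]
    · intro hg
      exact ⟨g.toWord, (hS _).2 ⟨g, hg, rfl⟩, FreeGroup.mk_toWord⟩
  · rw [← Set.ncard_image_of_injective T FreeGroup.toWord_injective,
      ← List.toFinset_card_of_nodup ((nodup_wordsUpTo N).filter _), ← Set.ncard_coe_finset]
    congr 1
    ext w
    simp only [List.coe_toFinset]
    exact hS w

theorem mk_mem_generatedSubgroup {L : List (Word n)} {w : Word n} (hw : w ∈ L) :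
    FreeGroup.mk w ∈ generatedSubgroup L := Subgroup.subset_closure ⟨w, hw, rfl⟩

theorem generatedSubgroup_le {L : List (Word n)} {K : Subgroup (FreeGroup (Fin n))} :
    generatedSubgroup L ≤ K ↔ ∀ w ∈ L, FreeGroup.mk w ∈ K := by
  rw [generatedSubgroup, Subgroup.closure_le]
  constructor
  · exact fun h w hw => h ⟨w, hw, rfl⟩
  · rintro h _ ⟨w, hw, rfl⟩
    exact h w hw

theorem range_mk_get (S : List (Word n)) :
    Set.range (fun i : Fin S.length => FreeGroup.mk (S.get i)) =
      {g | ∃ w ∈ S, FreeGroup.mk w = g} := by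
  ext g
  constructor
  · rintro ⟨i, rfl⟩
    exact ⟨_, S.get_mem i, rfl⟩
  · rintro ⟨w, hw, rfl⟩
    obtain ⟨i, rfl⟩ := List.get_of_mem hw
    exact ⟨i, rfl⟩

theorem rank_generatedSubgroup_le (S : List (Word n)) :
    Group.rank (generatedSubgroup S) ≤ S.length := by
  have hfin : Finite (Set.range fun i : Fin S.length => FreeGroup.mk (S.get i)) := inferInstance
  have h := Subgroup.rank_closure_finite_le_nat_card
    (Set.range fun i : Fin S.length => FreeGroup.mk (S.get i))
  have e : Subgroup.closure (Set.range fun i : Fin S.length => FreeGroup.mk (S.get i)) =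
      generatedSubgroup S := congrArg Subgroup.closure (range_mk_get S)
  rw [Subgroup.rank_congr e] at h
  refine h.trans ((Finite.card_range_le _).trans ?_)
  simp

/-- An instance of the Hopf property, through `exists_basis_of_card_eq_rank`. -/
theorem isFreeBasisOf_of_rank_eq {S : List (Word n)}
    (h : S.length = Group.rank (generatedSubgroup S)) : IsFreeBasisOf S (generatedSubgroup S) := by
  let s : Fin S.length → generatedSubgroup S := fun i =>
    ⟨FreeGroup.mk (S.get i), mk_mem_generatedSubgroup (S.get_mem i)⟩
  have hs : Subgroup.closure (Set.range s) = ⊤ := by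
    apply Subgroup.map_injective (generatedSubgroup S).subtype_injective
    rw [MonoidHom.map_closure, ← Set.range_comp, ← MonoidHom.range_eq_map, Subgroup.range_subtype]
    exact congrArg Subgroup.closure (range_mk_get S)
  obtain ⟨b, hb⟩ := exists_basis_of_card_eq_rank s hs h
  exact ⟨b, fun i => congrArg Subtype.val (hb i)⟩

theorem length_le_length_flatten {L : List (Word n)} {w : Word n} (hw : w ∈ L) :
    w.length ≤ L.flatten.length := (List.sublist_flatten_of_mem hw).length_le

/-- Every finitely generated subgroup that contains the subgroup generated by given words has a
subgroup of at most the same rank that contains them too and is generated by short words. -/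
theorem exists_short_generators (L : List (Word n)) {N : ℕ} (hN : L.flatten.length ≤ N)
    (K : Subgroup (FreeGroup (Fin n))) [Group.FG K] (hK : generatedSubgroup L ≤ K) :
    ∃ S ∈ (wordsUpTo n N).sublists', generatedSubgroup L ≤ generatedSubgroup S ∧
      generatedSubgroup S ≤ K ∧ S.length ≤ Group.rank K := by
  have hshort : ∀ g ∈ {g | ∃ w ∈ L, FreeGroup.mk w = g}, g.norm ≤ N := by
    rintro _ ⟨w, hw, rfl⟩
    exact FreeGroup.norm_mk_le.trans ((length_le_length_flatten hw).trans hN)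
  obtain ⟨T, hT, hLT, ⟨B, hB⟩, hcard⟩ := exists_short_free_factor rfl hshort hK
  obtain ⟨_, _⟩ := hB.fg
  obtain ⟨S, hS, hST, hlen⟩ := exists_sublist_wordsUpTo hT
  refine ⟨S, hS, hST ▸ hLT, ?_, ?_⟩
  · rw [hST, ← hB.2]
    exact le_sup_left
  · have := hB.rank_add
    rw [hlen, hcard]
    omega

/-- A list of words that represents a set which is closed under short quotients. -/
def IsClosedList (N : ℕ) (A : List (Word n)) : Prop :=
  [] ∈ A ∧ ∀ u ∈ A, ∀ v ∈ A, (FreeGroup.reduce (FreeGroup.invRev u ++ v)).length ≤ N →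
    FreeGroup.reduce (FreeGroup.invRev u ++ v) ∈ A

/-- Every closed list of short words that contains `S` contains `T` (up to reduction). -/
def Covers (N : ℕ) (S T : List (Word n)) : Prop :=
  ∀ A ∈ (wordsUpTo n N).sublists', IsClosedList N A → (∀ s ∈ S, FreeGroup.reduce s ∈ A) →
    ∀ t ∈ T, FreeGroup.reduce t ∈ A

/-- In one direction, the short words that represent elements of `generatedSubgroup S` form a closed
list to test against. In the other, a closed list is a partial subgroup, so it already contains
every short element generated by `S`. The bound is even because the finite action lives on words of
half the length. -/
theorem covers_iff {M : ℕ} {S T : List (Word n)} (hS : ∀ s ∈ S, s.length ≤ 2 * M)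
    (hT : ∀ t ∈ T, t.length ≤ 2 * M) :
    Covers (2 * M) S T ↔ generatedSubgroup T ≤ generatedSubgroup S := by
  classical
  rw [generatedSubgroup_le]
  constructor
  · intro h t ht
    let K := generatedSubgroup S
    let A := (wordsUpTo n (2 * M)).filter fun w => FreeGroup.mk w ∈ K
    have hA : ∀ w, w ∈ A ↔ w.length ≤ 2 * M ∧ FreeGroup.mk w ∈ K := fun w => by
      simp only [A, List.mem_filter, decide_eq_true_eq, mem_wordsUpTo]
    have hcl : IsClosedList (2 * M) A := by
      refine ⟨(hA _).2 ⟨by simp, K.one_mem⟩, fun u hu v hv huv => (hA _).2 ⟨huv, ?_⟩⟩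
      rw [FreeGroup.reduce.self, ← FreeGroup.mul_mk, ← FreeGroup.inv_mk]
      exact K.mul_mem (K.inv_mem ((hA u).1 hu).2) ((hA v).1 hv).2
    have := h A (List.mem_sublists'.2 List.filter_sublist) hcl (fun s hs => (hA _).2
      ⟨FreeGroup.norm_mk_le.trans (hS s hs), by
        rw [FreeGroup.reduce.self]; exact mk_mem_generatedSubgroup hs⟩) t ht
    have := ((hA _).1 this).2
    rwa [FreeGroup.reduce.self] at this
  · intro h A _ hcl hSA t ht
    have hA : IsPartialSubgroup (2 * M) {g : FreeGroup (Fin n) | g.toWord ∈ A} := by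
      refine ⟨hcl.1, fun a ha b hb hab => ?_⟩
      rw [FreeGroup.norm, FreeGroup.toWord_mul, FreeGroup.toWord_inv] at hab
      rw [Set.mem_ofPred_eq, FreeGroup.toWord_mul, FreeGroup.toWord_inv]
      exact hcl.2 _ ha _ hb hab
    refine hA.mem_of_mem_closure ?_ ?_ (h t ht) (FreeGroup.norm_mk_le.trans (hT t ht))
    · rintro _ ⟨s, hs, rfl⟩
      exact hSA s hs
    · rintro _ ⟨s, hs, rfl⟩
      exact FreeGroup.norm_mk_le.trans (hS s hs)

/-- `S` is a shortest list of short words that generate a subgroup that contains `L`. -/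
def IsLeastCover (N : ℕ) (L S : List (Word n)) : Prop :=
  S ∈ (wordsUpTo n N).sublists' ∧ Covers N S L ∧
    ∀ S' ∈ (wordsUpTo n N).sublists', Covers N S' L → S.length ≤ S'.length

/-- `R` is a shortest list of short words that generate the same subgroup as `L`. -/
def IsLeastGeneratingList (N : ℕ) (L R : List (Word n)) : Prop :=
  R ∈ (wordsUpTo n N).sublists' ∧ (Covers N R L ∧ Covers N L R) ∧
    ∀ R' ∈ (wordsUpTo n N).sublists', Covers N R' L ∧ Covers N L R' → R.length ≤ R'.length

theorem exists_shortest {β : Type*} {X : List (List β)} {p : List β → Prop} (h : ∃ S ∈ X, p S) :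
    ∃ S ∈ X, p S ∧ ∀ S' ∈ X, p S' → S.length ≤ S'.length := by
  classical
  have h' : ∃ k, ∃ S ∈ X, p S ∧ S.length = k := by
    obtain ⟨S, hS, hp⟩ := h
    exact ⟨_, S, hS, hp, rfl⟩
  obtain ⟨S, hS, hp, hk⟩ := Nat.find_spec h'
  exact ⟨S, hS, hp, fun S' hS' hp' => hk.trans_le (Nat.find_min' h' ⟨S', hS', hp', rfl⟩)⟩

theorem length_le_of_mem_sublists {N : ℕ} {S : List (Word n)}
    (hS : S ∈ (wordsUpTo n N).sublists') : ∀ s ∈ S, s.length ≤ N :=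
  fun _ hs => mem_wordsUpTo.1 ((List.mem_sublists'.1 hS).subset hs)

section Bound

variable {L : List (Word n)} {M : ℕ} (hM : L.flatten.length ≤ M)
include hM

theorem length_le_two_mul : ∀ w ∈ L, w.length ≤ 2 * M := fun w hw => by
  have := length_le_length_flatten hw
  omega

theorem exists_isLeastCover : ∃ S, IsLeastCover (2 * M) L S := by
  obtain ⟨S, hS, h, -, -⟩ := exists_short_generators L (N := 2 * M) (by omega)
    (generatedSubgroup L) le_rfl
  exact exists_shortest (p := fun S => Covers (2 * M) S L) ⟨S, hS, (covers_iff
    (length_le_of_mem_sublists hS) (length_le_two_mul hM)).2 h⟩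

theorem exists_isLeastGeneratingList : ∃ R, IsLeastGeneratingList (2 * M) L R := by
  obtain ⟨S, hS, h, h', -⟩ := exists_short_generators L (N := 2 * M) (by omega)
    (generatedSubgroup L) le_rfl
  exact exists_shortest (p := fun R => Covers (2 * M) R L ∧ Covers (2 * M) L R) ⟨S, hS,
    (covers_iff (length_le_of_mem_sublists hS) (length_le_two_mul hM)).2 h,
    (covers_iff (length_le_two_mul hM) (length_le_of_mem_sublists hS)).2 h'⟩

theorem IsLeastCover.le {S : List (Word n)} (h : IsLeastCover (2 * M) L S) :
    generatedSubgroup L ≤ generatedSubgroup S :=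
  (covers_iff (length_le_of_mem_sublists h.1) (length_le_two_mul hM)).1 h.2.1

/-- Minimality among short lists is enough, since every finitely generated overgroup contains a
short cover no longer than its rank. -/
theorem IsLeastCover.length_le {S : List (Word n)} (h : IsLeastCover (2 * M) L S)
    (K : Subgroup (FreeGroup (Fin n))) [Group.FG K] (hK : generatedSubgroup L ≤ K) :
    S.length ≤ Group.rank K := by
  obtain ⟨S', hS', hL, -, hr⟩ := exists_short_generators L (N := 2 * M) (by omega) K hK
  exact (h.2.2 S' hS' ((covers_iff (length_le_of_mem_sublists hS')
    (length_le_two_mul hM)).2 hL)).trans hr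

theorem IsLeastCover.length_eq {S : List (Word n)} (h : IsLeastCover (2 * M) L S) :
    S.length = Group.rank (generatedSubgroup S) :=
  le_antisymm (h.length_le hM _ (h.le hM)) (rank_generatedSubgroup_le S)

theorem IsLeastGeneratingList.length_eq {R : List (Word n)}
    (h : IsLeastGeneratingList (2 * M) L R) :
    R.length = Group.rank (generatedSubgroup L) := by
  have hR := length_le_of_mem_sublists h.1
  have hL := length_le_two_mul hM
  have e : generatedSubgroup R = generatedSubgroup L :=
    le_antisymm ((covers_iff hL hR).1 h.2.1.2) ((covers_iff hR hL).1 h.2.1.1)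
  refine le_antisymm ?_ ?_
  · obtain ⟨S', hS', hL', hL'', hr⟩ := exists_short_generators L (N := 2 * M) (by omega)
      (generatedSubgroup L) le_rfl
    exact (h.2.2 S' hS' ⟨(covers_iff (length_le_of_mem_sublists hS') hL).2 hL',
      (covers_iff hL (length_le_of_mem_sublists hS')).2 hL''⟩).trans hr
  · rw [← Subgroup.rank_congr e]
    exact rank_generatedSubgroup_le R

end Bound

/-- The numbers `p` and `q` are the numerator and the denominator of the quotient of the reduced
ranks that belong to the ranks `r` and `s`; the numbers `u` and `v` witness that they are
coprime. -/
def IsReducedQuotient (r s p q u v : ℕ) : Prop :=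
  (r ≤ 1 ∧ p = 1 ∧ q = 1) ∨
    (1 < r ∧ 0 < q ∧ p * (s - 1) = q * (r - 1) ∧ p * u = q * v + 1)

theorem exists_bezout {p q : ℕ} (hp : 0 < p) (hq : 0 < q) (h : Nat.Coprime p q) :
    ∃ u v, p * u = q * v + 1 := by
  -- Modulo `1` no residue equals `1`, so this case needs its own witness.
  by_cases h1 : q = 1
  · exact ⟨1, p - 1, by subst h1; omega⟩
  · obtain ⟨m, -, hm⟩ := Nat.exists_mul_mod_eq_one_of_coprime h (by omega)
    have := Nat.div_add_mod (p * m) q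
    exact ⟨m, p * m / q, by rw [hm] at this; exact this.symm⟩

/-- The hypothesis keeps the denominator `s - 1` positive when the numerator is; for `r ≤ 1` the
value is the convention `0 / 0 = 1`. -/
theorem exists_isReducedQuotient {r s : ℕ} (h : 1 < r → 1 < s) :
    ∃ p q u v, IsReducedQuotient r s p q u v := by
  by_cases hr : r ≤ 1
  · exact ⟨1, 1, 0, 0, Or.inl ⟨hr, rfl, rfl⟩⟩
  · have hr' : 0 < r - 1 := by omega
    have hs' : 0 < s - 1 := by have := h (by omega); omega
    have hg := Nat.gcd_pos_of_pos_left (s - 1) hr'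
    obtain ⟨g, p, q, hg', hco, hp, hq⟩ := Nat.exists_coprime' hg
    have hp' : 0 < p := Nat.pos_of_ne_zero fun h0 => by simp [h0] at hp; omega
    have hq' : 0 < q := Nat.pos_of_ne_zero fun h0 => by simp [h0] at hq; omega
    obtain ⟨u, v, huv⟩ := exists_bezout hp' hq' hco
    refine ⟨p, q, u, v, Or.inr ⟨by omega, hq', ?_, huv⟩⟩
    rw [hp, hq]
    ring

theorem IsReducedQuotient.coprime {r s p q u v : ℕ} (h : IsReducedQuotient r s p q u v) :
    0 < q ∧ Nat.Coprime p q := by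
  rcases h with ⟨-, rfl, rfl⟩ | ⟨-, hq, -, huv⟩
  · simp
  · refine ⟨hq, Nat.Coprime.symm (Nat.isCoprime_iff_coprime.1 ⟨-v, u, ?_⟩)⟩
    have : (p : ℤ) * u = q * v + 1 := by exact_mod_cast huv
    linarith

theorem IsReducedQuotient.compressionRatio_eq {G : Type*} [Group G] {H K : Subgroup G}
    [Group.FG H] [Group.FG K] (hHK : H ≤ K) (hle : Group.rank K ≤ Group.rank H) {p q u v : ℕ}
    (h : IsReducedQuotient (Group.rank H) (Group.rank K) p q u v) :
    compressionRatio H K = (p : ℝ) / q := by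
  have hone := rank_le_one_of_le hHK
  unfold compressionRatio reducedRank
  rcases h with ⟨hr, rfl, rfl⟩ | ⟨hr, hq, hpq, -⟩
  · rw [if_pos ⟨by omega, by omega⟩]
    simp
  · have hs : 1 < Group.rank K := by
      by_contra hs
      have := hone (by omega)
      omega
    rw [if_neg (by omega), div_eq_div_iff]
    · rw [mul_comm]
      exact_mod_cast hpq.symm
    · exact_mod_cast (by omega : Group.rank K - 1 ≠ 0)
    · exact_mod_cast hq.ne'

end Words

/-! ### Primitive recursiveness of the tests -/

section PrimitiveRecursion

open Primrec

variable {β γ : Type*} [Primcodable β] [Primcodable γ]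

theorem primrecPred_forall_mem {f : γ → List β} {R : γ → β → Prop} (hf : Primrec f)
    (hR : PrimrecRel R) : PrimrecPred fun a => ∀ b ∈ f a, R a b :=
  (PrimrecRel.forall_mem_list (R := fun b a => R a b) hR.swap).comp hf .id

theorem primrecPred_imp {p q : γ → Prop} (hp : PrimrecPred p) (hq : PrimrecPred q) :
    PrimrecPred fun a => p a → q a :=
  (hp.not.or hq).of_eq fun _ => imp_iff_not_or.symm

theorem primrecRel_mem : PrimrecRel fun (b : β) (l : List β) => b ∈ l :=
  ((PrimrecRel.exists_mem_list (R := fun a b : β => a = b) Primrec.eq).comp snd fst).of_eq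
    fun p => by simp

theorem primrec_sublists' : Primrec (List.sublists' : List β → List (List β)) :=
  (list_foldr (h := fun _ (p : β × List (List β)) => p.2 ++ p.2.map (List.cons p.1)) .id
    (const [[]]) (list_append.comp (snd.comp snd) (list_map (snd.comp snd)
      (list_cons.comp (fst.comp (snd.comp fst)) snd).to₂)).to₂).of_eq fun l => by
    induction l with
    | nil => rfl
    | cons a l ih =>
      rw [id_eq] at ih ⊢
      rw [List.foldr_cons, ih, List.sublists'_cons]

/-- For fixed `n` the list of letters is a constant, so the arbitrary choice of its order is
harmless. -/
theorem primrec_wordsUpTo (n : ℕ) : Primrec (wordsUpTo n) :=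
  (nat_rec₁ (f := fun _ ih => [] :: (Finset.univ : Finset (Fin n × Bool)).toList.flatMap
      fun x => ih.map (List.cons x)) [[]]
    (list_cons.comp (const []) (list_flatMap (const _) (list_map (snd.comp fst)
      (list_cons.comp (snd.comp fst) snd).to₂).to₂)).to₂).of_eq fun N => by
    induction N with
    | zero => rfl
    | succ N ih => rw [wordsUpTo, ← ih]

/-- Reduction is a right fold whose step cancels the new letter against the head or prepends it. -/
theorem primrec_reduce (n : ℕ) : Primrec (FreeGroup.reduce : Word n → Word n) := by
  have hstep : Primrec fun p : (Fin n × Bool) × Word n =>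
      (List.casesOn p.2 [p.1] fun y l => if p.1.1 = y.1 ∧ p.1.2 = !y.2 then l else p.1 :: y :: l :
        Word n) := by
    refine list_casesOn (h := fun (p : (Fin n × Bool) × Word n) (z : (Fin n × Bool) × Word n) =>
      if p.1.1 = z.1.1 ∧ p.1.2 = !z.1.2 then z.2 else p.1 :: z.1 :: z.2)
      snd (list_cons.comp fst (const [])) ?_
    refine Primrec.ite (PrimrecPred.and ?_ ?_) (snd.comp snd)
      (list_cons.comp (fst.comp fst) (list_cons.comp (fst.comp snd) (snd.comp snd)))
    · exact Primrec.eq.comp (fst.comp (fst.comp fst)) (fst.comp (fst.comp snd))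
    · exact Primrec.eq.comp (snd.comp (fst.comp fst))
        (Primrec.not.comp (snd.comp (fst.comp snd)))
  refine (list_foldr .id (const []) (hstep.comp snd).to₂).of_eq fun l => ?_
  induction l with
  | nil => rfl
  | cons x l ih =>
    rw [id_eq] at ih ⊢
    rw [List.foldr_cons, ih, FreeGroup.reduce.cons]

theorem primrec_invRev (n : ℕ) : Primrec (FreeGroup.invRev : Word n → Word n) :=
  list_reverse.comp (list_map .id
    (Primrec.pair (fst.comp snd) (Primrec.not.comp (snd.comp snd))).to₂)

theorem primrecRel_isClosedList (n : ℕ) : PrimrecRel (IsClosedList (n := n)) := by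
  refine PrimrecPred.and (primrecRel_mem.comp (const []) snd) ?_
  refine primrecPred_forall_mem snd ?_
  refine primrecPred_forall_mem (snd.comp fst) ?_
  have hred : Primrec fun x : ((ℕ × List (Word n)) × Word n) × Word n =>
      FreeGroup.reduce (FreeGroup.invRev x.1.2 ++ x.2) :=
    (primrec_reduce n).comp
      (list_append.comp ((primrec_invRev n).comp (snd.comp fst)) snd)
  exact primrecPred_imp (nat_le.comp (list_length.comp hred) (fst.comp (fst.comp fst)))
    (primrecRel_mem.comp hred (snd.comp (fst.comp fst)))

theorem primrecPred_covers (n : ℕ) :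
    PrimrecPred fun x : ℕ × List (Word n) × List (Word n) => Covers x.1 x.2.1 x.2.2 := by
  have hmem : ∀ {f : ℕ × List (Word n) × List (Word n) → List (Word n)}, Primrec f →
      PrimrecPred fun x : (ℕ × List (Word n) × List (Word n)) × List (Word n) =>
        ∀ s ∈ f x.1, FreeGroup.reduce s ∈ x.2 := fun hf =>
    primrecPred_forall_mem (hf.comp fst)
      (primrecRel_mem.comp ((primrec_reduce n).comp snd) (snd.comp fst))
  refine primrecPred_forall_mem (primrec_sublists'.comp ((primrec_wordsUpTo n).comp fst)) ?_
  exact primrecPred_imp ((primrecRel_isClosedList n).comp (fst.comp fst) snd)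
    (primrecPred_imp (hmem (fst.comp snd)) (hmem (snd.comp snd)))

theorem primrecPred_isLeastCover (n : ℕ) :
    PrimrecPred fun x : ℕ × List (Word n) × List (Word n) => IsLeastCover x.1 x.2.1 x.2.2 := by
  have hX : Primrec fun x : ℕ × List (Word n) × List (Word n) => (wordsUpTo n x.1).sublists' :=
    primrec_sublists'.comp ((primrec_wordsUpTo n).comp fst)
  refine PrimrecPred.and (primrecRel_mem.comp (snd.comp snd) hX) (PrimrecPred.and
    ((primrecPred_covers n).comp (fst.pair ((snd.comp snd).pair (fst.comp snd))))
    (primrecPred_forall_mem hX (primrecPred_imp ?_ ?_)))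
  · exact (primrecPred_covers n).comp
      ((fst.comp fst).pair (snd.pair (fst.comp (snd.comp fst))))
  · exact nat_le.comp (list_length.comp (snd.comp (snd.comp fst))) (list_length.comp snd)

theorem primrecPred_isLeastGeneratingList (n : ℕ) :
    PrimrecPred fun x : ℕ × List (Word n) × List (Word n) =>
      IsLeastGeneratingList x.1 x.2.1 x.2.2 := by
  have hX : Primrec fun x : ℕ × List (Word n) × List (Word n) => (wordsUpTo n x.1).sublists' :=
    primrec_sublists'.comp ((primrec_wordsUpTo n).comp fst)
  refine PrimrecPred.and (primrecRel_mem.comp (snd.comp snd) hX) (PrimrecPred.and (PrimrecPred.and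
    ((primrecPred_covers n).comp (fst.pair ((snd.comp snd).pair (fst.comp snd))))
    ((primrecPred_covers n).comp (fst.pair ((fst.comp snd).pair (snd.comp snd)))))
    (primrecPred_forall_mem hX (primrecPred_imp (PrimrecPred.and ?_ ?_) ?_)))
  · exact (primrecPred_covers n).comp
      ((fst.comp fst).pair (snd.pair (fst.comp (snd.comp fst))))
  · exact (primrecPred_covers n).comp
      ((fst.comp fst).pair ((fst.comp (snd.comp fst)).pair snd))
  · exact nat_le.comp (list_length.comp (snd.comp (snd.comp fst))) (list_length.comp snd)

theorem primrecPred_isReducedQuotient {r s p q u v : γ → ℕ} (hr : Primrec r) (hs : Primrec s)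
    (hp : Primrec p) (hq : Primrec q) (hu : Primrec u) (hv : Primrec v) :
    PrimrecPred fun a => IsReducedQuotient (r a) (s a) (p a) (q a) (u a) (v a) := by
  refine PrimrecPred.or (PrimrecPred.and (nat_le.comp hr (const 1)) (PrimrecPred.and
    (Primrec.eq.comp hp (const 1)) (Primrec.eq.comp hq (const 1)))) ?_
  refine PrimrecPred.and (nat_lt.comp (const 1) hr) (PrimrecPred.and (nat_lt.comp (const 0) hq)
    (PrimrecPred.and (Primrec.eq.comp ?_ ?_) (Primrec.eq.comp ?_ ?_)))
  · exact nat_mul.comp hp (nat_sub.comp hs (const 1))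
  · exact nat_mul.comp hq (nat_sub.comp hr (const 1))
  · exact nat_mul.comp hp hu
  · exact nat_add.comp (nat_mul.comp hq hv) (const 1)

end PrimitiveRecursion

/-! ### Certificates and unbounded search -/

/-- What the search for the degree of compression looks for: the numerator and the denominator of
the degree of compression and a basis of an extension of least rank, a basis of the subgroup, and
a witness of coprimality. -/
abbrev Certificate (n : ℕ) : Type :=
  ((ℕ × ℕ) × List (Word n)) × List (Word n) × ℕ × ℕ

/-- The certificate `c` determines the degree of compression of the subgroup generated by `L`. -/
def IsCertificate {n : ℕ} (L : List (Word n)) (c : Certificate n) : Prop :=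
  IsLeastCover (2 * L.flatten.length) L c.1.2 ∧
  IsLeastGeneratingList (2 * L.flatten.length) L c.2.1 ∧
  IsReducedQuotient c.2.1.length c.1.2.length c.1.1.1 c.1.1.2 c.2.2.1 c.2.2.2

open Primrec in
theorem primrecRel_isCertificate (n : ℕ) : PrimrecRel (IsCertificate (n := n)) := by
  have hN : Primrec fun x : List (Word n) × Certificate n => 2 * x.1.flatten.length :=
    nat_mul.comp (const 2) (list_length.comp (list_flatten.comp fst))
  exact PrimrecPred.and
    ((primrecPred_isLeastCover n).comp (hN.pair (fst.pair (snd.comp (fst.comp snd)))))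
    (PrimrecPred.and ((primrecPred_isLeastGeneratingList n).comp
      (hN.pair (fst.pair (fst.comp (snd.comp snd)))))
    (primrecPred_isReducedQuotient (list_length.comp (fst.comp (snd.comp snd)))
      (list_length.comp (snd.comp (fst.comp snd)))
      (fst.comp (fst.comp (fst.comp snd))) (snd.comp (fst.comp (fst.comp snd)))
      (fst.comp (snd.comp (snd.comp snd))) (snd.comp (snd.comp (snd.comp snd)))))

/-- A decidable search that always succeeds is computable. -/
theorem exists_computable_of_primrecRel {β γ : Type*} [Primcodable β] [Primcodable γ]
    {R : β → γ → Prop} (hR : PrimrecRel R) (h : ∀ b, ∃ c, R b c) :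
    ∃ f : β → γ, Computable f ∧ ∀ b, R b (f b) := by
  classical
  -- Candidate `m` is decoded and tested; `Nat.rfindOpt` returns the first success, which exists by
  -- `h`.
  let F : β → ℕ → Option γ := fun b m =>
    (Encodable.decode m : Option γ).bind fun c => if R b c then some c else none
  have hF : Primrec₂ F := Primrec.option_bind (Primrec.decode.comp Primrec.snd)
    (Primrec.ite (hR.comp (Primrec.fst.comp Primrec.fst) Primrec.snd)
      (Primrec.option_some.comp Primrec.snd) (Primrec.const none)).to₂
  have hdom : ∀ b, (Nat.rfindOpt (F b)).Dom := fun b => by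
    obtain ⟨c, hc⟩ := h b
    exact Nat.rfindOpt_dom.2 ⟨Encodable.encode c, c, by simp [F, hc]⟩
  refine ⟨fun b => (Nat.rfindOpt (F b)).get (hdom b), ?_, fun b => ?_⟩
  · exact (Partrec.rfindOpt hF.to_comp).of_eq fun b => (Part.some_get (hdom b)).symm
  · obtain ⟨m, hm⟩ := Nat.rfindOpt_spec (Part.get_mem (hdom b))
    beta_reduce
    generalize (Nat.rfindOpt (F b)).get (hdom b) = c at hm
    simp only [F, Option.mem_def, Option.bind_eq_some_iff] at hm
    obtain ⟨c', -, hc⟩ := hm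
    split_ifs at hc with hRc
    rwa [← Option.some.inj hc]

theorem exists_isCertificate {n : ℕ} (L : List (Word n)) : ∃ c, IsCertificate L c := by
  obtain ⟨S, hS⟩ := exists_isLeastCover (L := L) le_rfl
  obtain ⟨R, hR⟩ := exists_isLeastGeneratingList (L := L) le_rfl
  have h : 1 < R.length → 1 < S.length := by
    rw [hR.length_eq le_rfl, hS.length_eq le_rfl]
    have := rank_le_one_of_le (hS.le le_rfl)
    omega
  obtain ⟨p, q, u, v, hq⟩ := exists_isReducedQuotient h
  exact ⟨(((p, q), S), R, u, v), hS, hR, hq⟩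

end FreeCompression

open FreeCompression
theorem theorem1p8 (n : ℕ) :
    -- the degree of compression is the maximum over the finitely many algebraic extensions
    (∀ (H : Subgroup (FreeGroup (Fin n))) [Group.FG H],
      IsGreatest (compressionRatios H) (degreeOfCompression H) ∧
      (algebraicExtensions H).Finite ∧
      IsGreatest (algebraicCompressionRatios H) (degreeOfCompression H)) ∧
    -- an algorithm maps generators of `H` to the numerator and the denominator of the degree of
    -- compression of `H`, and to a free basis of a subgroup at which it is attained
    (∃ f : List (Word n) → (ℕ × ℕ) × List (Word n), Computable f ∧
      ∀ L : List (Word n),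
        0 < (f L).1.2 ∧ Nat.Coprime (f L).1.1 (f L).1.2 ∧
        degreeOfCompression (generatedSubgroup L) = ((f L).1.1 : ℝ) / ((f L).1.2 : ℝ) ∧
        IsFreeBasisOf (f L).2 (generatedSubgroup (f L).2) ∧
        generatedSubgroup L ≤ generatedSubgroup (f L).2 ∧
        generatedSubgroup (f L).2 ∈ algebraicExtensions (generatedSubgroup L) ∧
        compressionRatio (generatedSubgroup L) (generatedSubgroup (f L).2) =
          degreeOfCompression (generatedSubgroup L)) := by
  refine ⟨fun H _ => ?_, ?_⟩
  · obtain ⟨K, _, hHK, hmin⟩ := exists_rank_minimal H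
    have hdc := degreeOfCompression_eq hHK @hmin
    have hgr := isGreatest_compressionRatio hHK @hmin
    rw [hdc]
    refine ⟨hgr, finite_algebraicExtensions H,
      ⟨K, inferInstance, mem_algebraicExtensions_of_rank_le hHK @hmin, rfl⟩, ?_⟩
    rintro _ ⟨K', _, hK', rfl⟩
    exact hgr.2 ⟨K', inferInstance, hK'.2.1, rfl⟩
  · obtain ⟨f, hf, hcert⟩ :=
      exists_computable_of_primrecRel (primrecRel_isCertificate n) exists_isCertificate
    refine ⟨fun L => (f L).1, Computable.fst.comp hf, fun L => ?_⟩
    obtain ⟨hS, hR, hq⟩ := hcert L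
    have hle := hS.le le_rfl
    have hlen := hS.length_eq le_rfl
    have hmin : ∀ (K : Subgroup (FreeGroup (Fin n))) [Group.FG K], generatedSubgroup L ≤ K →
        Group.rank (generatedSubgroup (f L).1.2) ≤ Group.rank K := fun K _ hK =>
      hlen ▸ hS.length_le le_rfl K hK
    have hdc := degreeOfCompression_eq hle @hmin
    obtain ⟨hpos, hcop⟩ := hq.coprime
    -- The lengths in the certificate are the ranks of `H` and of its least cover, so the computed
    -- fraction is the compression ratio.
    rw [hR.length_eq le_rfl, hlen] at hq
    exact ⟨hpos, hcop, hdc.trans (hq.compressionRatio_eq hle (hmin _ le_rfl)),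
      isFreeBasisOf_of_rank_eq hlen, hle, mem_algebraicExtensions_of_rank_le hle @hmin, hdc.symm⟩
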